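/- Let $n\ge 0$ and let $A=[a_{ij}]_{1\le i,j\le n}$ be an integer matrix with $a_{ii}=2$, $a_{ij}\le 0$ for $i\ne j$, and $d_i a_{ij}=d_j a_{ji}$ for some real $d_1,\dots,d_n>0$. Let $V$ be the complex vector space with basis $\alpha_1,\dots,\alpha_n$ (the simple roots), put $\alpha_i^\vee=d_i^{-1}\alpha_i$, and let $K$ be the symmetric bilinear form on $V$ with $K(\alpha_i^\vee,\alpha_j)=a_{ij}$. Assume that $A$ is of affine type: on the real span of the simple roots $K$ is positive semidefinite but not positive definite, and the restriction of $K$ to the real span of any proper subset of the simple roots is positive definite. (Hence $n\ge2$.) Let $s_i(x)=x-K(\alpha_i^\vee,x)\alpha_i$ be the simple reflections. For $\beta\in V$ with $K(\beta,\beta)\neq0$ put $\beta^\vee=\frac{2}{K(\beta,\beta)}\beta$ and $t_\beta(x)=x-K(\beta^\vee,x)\beta$. Let $\delta$ be the smallest positive imaginary root, that is, the coordinatewise least among the nonzero nonnegative integer combinations of simple roots lying in the kernel of $K$ (such a least element exists). Fix an index $\mathrm{aff}$ (any index is allowed; the usual choice is the affine node, for which the Weyl group is the semidirect product of the subgroup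 generated by the $s_i$, $i\neq\mathrm{aff}$, and a lattice of translations). Let $V_{\mathrm{fin}}$ be the span of the $\alpha_i$ with $i\neq\mathrm{aff}$, and let $\theta=\delta-[\delta:\alpha_{\mathrm{aff}}]\,\alpha_{\mathrm{aff}}\in V_{\mathrm{fin}}$, where $[\delta:\alpha_{\mathrm{aff}}]$ is the coefficient of $\alpha_{\mathrm{aff}}$ in $\delta$. Let $c=c_\triangleleft s_{\mathrm{aff}}c_\triangleright$ be a Coxeter element, i.e. the product of all the simple reflections, each occurring once, in some order, where $c_\triangleleft$ and $c_\triangleright$ are the products of the simple reflections before and after $s_{\mathrm{aff}}$ in this order. Then: 1. $c$ has eigenvalue $1$ with algebraic multiplicity $2$ and geometric multiplicity $1$, and $\delta$ is a $1$-eigenvector of $c$. 2. There is a unique vector $\gamma_c\in V_{\mathrm{fin}}$ that is a generalized $1$-eigenvector of $c$ in the sense that $(c-1)\gamma_c=\delta$. It lies in the real span of the simple roots, and it is the unique vector of $V_{\mathrm{fin}}$ that is fixed by $c_\triangleleft t_\theta c_\triangleright$ and satisfies $K(\theta^\vee,c_\triangleright\gamma_c)=1$. 3. There is a linearly independent set of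 $n-2$ eigenvectors of $c$ whose eigenvalues are roots of unity different from $1$. 4. The sum $U_c$ of all eigenspaces of $c$ in $V$ is $\{v\in V: K(\gamma_c,v)=0\}$. 5. For every $\lambda\in\mathbb{C}$ with $\lambda\ne1$, a vector $v\in V_{\mathrm{fin}}$ is a $\lambda$-eigenvector of $c_\triangleleft t_\theta c_\triangleright$ if and only if $v+\frac{K(\theta^\vee,c_\triangleright v)}{\lambda-1}\,\delta$ is a $\lambda$-eigenvector of $c$. -/

import Mathlib

namespace AffineCoxeter

noncomputable section

open scoped Matrix

/-- `A` is a symmetrizable (generalized) Cartan matrix with symmetrizing factors `d`: diagonal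
entries `2`, nonpositive off-diagonal entries, `d i > 0` and `d i * a i j = d j * a j i`. -/
structure IsSymmetrizableCartan {n : ℕ} (A : Matrix (Fin n) (Fin n) ℤ) (d : Fin n → ℝ) : Prop where
  diag : ∀ i, A i i = 2
  off_diag : ∀ i j, i ≠ j → A i j ≤ 0
  pos : ∀ i, 0 < d i
  symm : ∀ i j, d i * (A i j : ℝ) = d j * (A j i : ℝ)

/-- The Gram matrix `K(α_i, α_j) = d i * a i j` of the symmetric bilinear form `K` in the basis of
simple roots. -/
def gram {n : ℕ} (A : Matrix (Fin n) (Fin n) ℤ) (d : Fin n → ℝ) : Matrix (Fin n) (Fin n) ℝ :=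
  Matrix.of fun i j => d i * (A i j : ℝ)

/-- Affine type: `K` is positive semidefinite and not positive definite on the real span of the
simple roots, and its restriction to the span of every proper subset of the simple roots is
positive definite. -/
structure IsAffineType {n : ℕ} (A : Matrix (Fin n) (Fin n) ℤ) (d : Fin n → ℝ) : Prop where
  posSemidef : (gram A d).PosSemidef
  not_posDef : ¬ (gram A d).PosDef
  posDef_proper : ∀ J : Finset (Fin n), J ≠ Finset.univ →
    ((gram A d).submatrix (fun i : J => (i : Fin n)) (fun i : J => (i : Fin n))).PosDef

/-- The simple root `α_i`: the ambient complex vector space `V` is `Fin n → ℂ`, with the simple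
roots as its standard basis. -/
def simpleRoot {n : ℕ} (i : Fin n) : Fin n → ℂ := Pi.single i 1

/-- The symmetric complex bilinear form `K` on `V` with `K(α_i, α_j) = d i * a i j`, that is,
`K(α_i^∨, α_j) = a i j`. -/
def form {n : ℕ} (A : Matrix (Fin n) (Fin n) ℤ) (d : Fin n → ℝ) :
    (Fin n → ℂ) →ₗ[ℂ] (Fin n → ℂ) →ₗ[ℂ] ℂ :=
  Matrix.toLinearMap₂' ℂ ((gram A d).map (fun x : ℝ => (x : ℂ)))

/-- The simple co-root `α_i^∨ = d_i⁻¹ α_i`. -/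
def simpleCoroot {n : ℕ} (d : Fin n → ℝ) (i : Fin n) : Fin n → ℂ :=
  ((d i : ℂ)⁻¹) • simpleRoot i

/-- The simple reflection `s_i`, `x ↦ x - K(α_i^∨, x) α_i`. -/
def simpleReflection {n : ℕ} (A : Matrix (Fin n) (Fin n) ℤ) (d : Fin n → ℝ) (i : Fin n) :
    Module.End ℂ (Fin n → ℂ) :=
  LinearMap.id - (form A d (simpleCoroot d i)).smulRight (simpleRoot i)

/-- The co-root `β^∨ = (2 / K(β, β)) β` of a vector `β` with `K(β, β) ≠ 0`. -/
def coroot {n : ℕ} (A : Matrix (Fin n) (Fin n) ℤ) (d : Fin n → ℝ) (β : Fin n → ℂ) : Fin n → ℂ :=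
  (2 / form A d β β) • β

/-- The reflection `t_β`, `x ↦ x - K(β^∨, x) β`. -/
def reflection {n : ℕ} (A : Matrix (Fin n) (Fin n) ℤ) (d : Fin n → ℝ) (β : Fin n → ℂ) :
    Module.End ℂ (Fin n → ℂ) :=
  LinearMap.id - (form A d (coroot A d β)).smulRight β

/-- The product `s_{i₁} ⋯ s_{iₖ}` of simple reflections along a word `[i₁, …, iₖ]`. -/
def wordProd {n : ℕ} (A : Matrix (Fin n) (Fin n) ℤ) (d : Fin n → ℝ) (l : List (Fin n)) :
    Module.End ℂ (Fin n → ℂ) :=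
  (l.map (simpleReflection A d)).prod

/-- The word `l` lists every index exactly once, so that `wordProd A d l` is the product of a
permutation of the simple reflections, i.e. a Coxeter element. -/
def IsCoxeterWord {n : ℕ} (l : List (Fin n)) : Prop :=
  l.Nodup ∧ ∀ i, i ∈ l

/-- The positive imaginary roots of the affine root system: the nonzero nonnegative integer
combinations of simple roots that lie in the kernel of `K`. -/
def posImaginaryRoots {n : ℕ} (A : Matrix (Fin n) (Fin n) ℤ) (d : Fin n → ℝ) :
    Set (Fin n → ℕ) :=
  {β | β ≠ 0 ∧ ∀ v, form A d (fun i => (β i : ℂ)) v = 0}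

/-- The coordinates of the positive imaginary root closest to the origin. The positive imaginary
roots are the positive integer multiples of one of them, which is therefore found by minimizing
every coordinate. (The theorem asserts that this is a positive imaginary root, and the
coordinatewise least one.) -/
def deltaCoeff {n : ℕ} (A : Matrix (Fin n) (Fin n) ℤ) (d : Fin n → ℝ) (i : Fin n) : ℕ :=
  sInf {k | ∃ β ∈ posImaginaryRoots A d, β i = k}

/-- The imaginary root `δ` as a vector of `V`. -/
def delta {n : ℕ} (A : Matrix (Fin n) (Fin n) ℤ) (d : Fin n → ℝ) : Fin n → ℂ :=
  fun i => (deltaCoeff A d i : ℂ)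

/-- The vector `θ = δ - [δ : α_aff] α_aff`. -/
def theta {n : ℕ} (A : Matrix (Fin n) (Fin n) ℤ) (d : Fin n → ℝ) (aff : Fin n) : Fin n → ℂ :=
  delta A d - (deltaCoeff A d aff : ℂ) • simpleRoot aff

/-- The subspace `V_fin` of `V` spanned by the simple roots other than `α_aff`. -/
def Vfin {n : ℕ} (aff : Fin n) : Submodule ℂ (Fin n → ℂ) :=
  Submodule.span ℂ (simpleRoot '' {i | i ≠ aff})

/-- The real span of the simple roots. -/
def realSpan (n : ℕ) : Submodule ℝ (Fin n → ℂ) :=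
  Submodule.span ℝ (Set.range simpleRoot)

/-- `c_◁ s_aff c_▷`, where `c_◁` and `c_▷` are the products along the words `l` and `r`. -/
def coxeterElement {n : ℕ} (A : Matrix (Fin n) (Fin n) ℤ) (d : Fin n → ℝ) (aff : Fin n)
    (l r : List (Fin n)) : Module.End ℂ (Fin n → ℂ) :=
  wordProd A d l * simpleReflection A d aff * wordProd A d r

/-- `c_◁ t_θ c_▷`, where `c_◁` and `c_▷` are the products along the words `l` and `r`. -/
def finiteElement {n : ℕ} (A : Matrix (Fin n) (Fin n) ℤ) (d : Fin n → ℝ) (aff : Fin n)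
    (l r : List (Fin n)) : Module.End ℂ (Fin n → ℂ) :=
  wordProd A d l * reflection A d (theta A d aff) * wordProd A d r

end

end AffineCoxeter

open AffineCoxeter

namespace AffineCoxeter

noncomputable section

open scoped Matrix

variable {n : ℕ} {A : Matrix (Fin n) (Fin n) ℤ} {d : Fin n → ℝ}

/-! The radical of `K` is the line `ℂδ`: an isotropic real vector with a vanishing coordinate lies
in the span of a proper subset of the simple roots, where `K` is definite. Everything about `c`
follows from three facts. A vector fixed by `c` is orthogonal to every simple root, because each
coordinate is changed by only one reflection; so the fixed space is `ℂδ`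
(`form_eq_zero_of_wordProd_eq`, `eq_smul_delta`). The equation `(c - 1)γ = δ` is solvable: it
amounts to `K(α_k, γ) = -(Uδ)_k`, with `U` the triangular half of the Gram matrix `G = U + Uᵀ`, and
the Fredholm condition `δ·Uδ = 0` is half of `δ·Gδ = 0` (`exists_wordProd_eq_add_delta`). Modulo
`δ`, `c` has finite order, since it permutes integral vectors of bounded norm
(`exists_pow_wordProd_eq`). Let `φ = K(γ, ·)`. It is `c`-invariant since `δ` is in the radical, and
`φ(γ) ≠ 0` since `γ` is real, nonzero and has no `α_aff`-component. Invariance makes `φ` vanish on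
all eigenvectors and stops the Jordan chain at `γ`. Subtracting a multiple of `γ` from any vector
makes it fixed by a power of `c`, hence a sum of eigenvectors. The finite element is compared with
`c` through `t_θ = s_aff - K(θ^∨, ·)δ` and `c_◁ δ = δ`. -/

/-! ### The real and integral kernel of the Gram matrix -/

theorem gram_mulVec_apply (x : Fin n → ℝ) (i : Fin n) :
    (gram A d *ᵥ x) i = d i * ∑ j, (A i j : ℝ) * x j := by
  simp [gram, Matrix.mulVec, dotProduct, Finset.mul_sum, mul_assoc]

theorem IsAffineType.dotProduct_gram_nonneg (haff : IsAffineType A d) (x : Fin n → ℝ) :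
    0 ≤ x ⬝ᵥ gram A d *ᵥ x := by
  simpa using haff.posSemidef.dotProduct_mulVec_nonneg x

theorem IsAffineType.gram_mulVec_eq_zero (haff : IsAffineType A d) {x : Fin n → ℝ}
    (h : x ⬝ᵥ gram A d *ᵥ x = 0) : gram A d *ᵥ x = 0 :=
  (haff.posSemidef.dotProduct_mulVec_zero_iff x).1 (by simpa using h)

theorem IsAffineType.posDef_erase (haff : IsAffineType A d) (i : Fin n) :
    ((gram A d).submatrix (fun j : (Finset.univ.erase i : Finset (Fin n)) => (j : Fin n))
      (fun j : (Finset.univ.erase i : Finset (Fin n)) => (j : Fin n))).PosDef :=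
  haff.posDef_proper _ (by simp [Finset.ext_iff])

theorem sum_coe_erase {M : Type*} [AddCommMonoid M] (i : Fin n) (f : Fin n → M) (hf : f i = 0) :
    ∑ j : (Finset.univ.erase i : Finset (Fin n)), f j = ∑ j, f j := by
  rw [Finset.sum_coe_sort (Finset.univ.erase i) f, Finset.sum_erase _ hf]

theorem IsAffineType.eq_zero_of_apply_eq_zero (haff : IsAffineType A d) {x : Fin n → ℝ}
    {i : Fin n} (hi : x i = 0) (h : x ⬝ᵥ gram A d *ᵥ x = 0) : x = 0 := by
  by_contra hx
  let y : ((Finset.univ.erase i : Finset (Fin n)) : Type) → ℝ := fun j => x j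
  have hy : y ≠ 0 := by
    intro hy
    apply hx
    ext j
    by_cases hj : j = i
    · simp [hj, hi]
    · exact congrFun hy ⟨j, by simp [hj]⟩
  have hpos := (haff.posDef_erase i).dotProduct_mulVec_pos hy
  refine hpos.ne' ?_
  rw [← h]
  simp only [star_trivial, dotProduct, Matrix.mulVec, Matrix.submatrix_apply, y]
  rw [← sum_coe_erase i (fun j => x j * ∑ k, gram A d j k * x k) (by simp [hi])]
  refine Finset.sum_congr rfl fun j _ => ?_
  rw [sum_coe_erase i (fun k => gram A d j k * x k) (by simp [hi])]

theorem IsAffineType.exists_ne_zero (haff : IsAffineType A d) :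
    ∃ x : Fin n → ℝ, x ≠ 0 ∧ gram A d *ᵥ x = 0 := by
  by_contra! hc
  refine haff.not_posDef (Matrix.PosDef.of_dotProduct_mulVec_pos haff.posSemidef.1 fun x hx => ?_)
  rw [star_trivial]
  exact lt_of_le_of_ne (haff.dotProduct_gram_nonneg x)
    fun h => hc x hx (haff.gram_mulVec_eq_zero h.symm)

theorem IsSymmetrizableCartan.gram_mulVec_eq_zero_iff (hA : IsSymmetrizableCartan A d)
    (x : Fin n → ℝ) : gram A d *ᵥ x = 0 ↔ A.map (Int.cast : ℤ → ℝ) *ᵥ x = 0 := by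
  simp only [funext_iff, gram_mulVec_apply, Pi.zero_apply, mul_eq_zero, (hA.pos _).ne', false_or]
  simp [Matrix.mulVec, dotProduct]

/-- Diagonal terms are unchanged, and off-diagonal entries are nonpositive while products of
coordinates only grow. -/
theorem IsSymmetrizableCartan.dotProduct_gram_abs_le (hA : IsSymmetrizableCartan A d)
    (x : Fin n → ℝ) : |x| ⬝ᵥ gram A d *ᵥ |x| ≤ x ⬝ᵥ gram A d *ᵥ x := by
  simp only [dotProduct, gram_mulVec_apply, Finset.mul_sum, Pi.abs_apply]
  refine Finset.sum_le_sum fun i _ => Finset.sum_le_sum fun j _ => ?_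
  rcases eq_or_ne i j with rfl | hij
  · have := abs_mul_abs_self (x i)
    apply le_of_eq
    linear_combination (d i * (A i i : ℝ)) * this
  · have h1 : (A i j : ℝ) ≤ 0 := by exact_mod_cast hA.off_diag i j hij
    have h2 : x i * x j ≤ |x i| * |x j| := by rw [← abs_mul]; exact le_abs_self _
    nlinarith [mul_nonneg (mul_nonneg (hA.pos i).le (neg_nonneg.2 h1)) (sub_nonneg.2 h2)]

theorem IsAffineType.gram_mulVec_abs (haff : IsAffineType A d) (hA : IsSymmetrizableCartan A d)
    {x : Fin n → ℝ} (h : gram A d *ᵥ x = 0) : gram A d *ᵥ |x| = 0 := by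
  refine haff.gram_mulVec_eq_zero (le_antisymm ?_ (haff.dotProduct_gram_nonneg _))
  simpa [h] using hA.dotProduct_gram_abs_le x

/-- A real kernel vector forces `det A = 0` over `ℤ`, hence an integral kernel vector; its
coordinatewise absolute value is again in the kernel. -/
theorem IsAffineType.exists_nat_ne_zero (haff : IsAffineType A d)
    (hA : IsSymmetrizableCartan A d) :
    ∃ β : Fin n → ℕ, β ≠ 0 ∧ gram A d *ᵥ (fun i => (β i : ℝ)) = 0 := by
  obtain ⟨x, hx, hx0⟩ := haff.exists_ne_zero
  have hdet : (A.map (Int.cast : ℤ → ℝ)).det = 0 :=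
    Matrix.exists_mulVec_eq_zero_iff.1 ⟨x, hx, (hA.gram_mulVec_eq_zero_iff x).1 hx0⟩
  have hdet' : A.det = 0 := by
    have := Int.cast_det (R := ℝ) A
    rw [hdet] at this
    exact_mod_cast this
  obtain ⟨z, hz, hz0⟩ := Matrix.exists_mulVec_eq_zero_iff.2 hdet'
  refine ⟨fun i => (z i).natAbs, fun h => hz ?_, ?_⟩
  · ext i
    simpa using congrFun h i
  · have key : gram A d *ᵥ (fun i => (z i : ℝ)) = 0 := by
      ext i
      rw [gram_mulVec_apply]
      have := congrFun hz0 i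
      simp only [Matrix.mulVec, dotProduct, Pi.zero_apply] at this
      have h2 : ∑ j, (A i j : ℝ) * (z j : ℝ) = 0 := by exact_mod_cast this
      simp [h2]
    have := haff.gram_mulVec_abs hA key
    convert this using 2
    ext i
    simp [Nat.cast_natAbs]

/-! ### The complex form, its radical and the imaginary root `δ` -/

theorem form_apply (x y : Fin n → ℂ) :
    form A d x y = ∑ i, x i * ((d i : ℂ) * ∑ j, (A i j : ℂ) * y j) := by
  simp [form, Matrix.toLinearMap₂'_apply', dotProduct, Matrix.mulVec, gram, Finset.mul_sum,
    mul_assoc]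

theorem form_ofReal (x y : Fin n → ℝ) :
    form A d (fun i => (x i : ℂ)) (fun i => (y i : ℂ)) = ((x ⬝ᵥ gram A d *ᵥ y : ℝ) : ℂ) := by
  simp only [form_apply, dotProduct, gram_mulVec_apply]
  push_cast
  rfl

theorem form_simpleRoot (i : Fin n) (y : Fin n → ℂ) :
    form A d (simpleRoot i) y = (d i : ℂ) * ∑ j, (A i j : ℂ) * y j := by
  rw [form_apply, Finset.sum_eq_single i] <;> simp +contextual [simpleRoot]

theorem form_simpleRoot_ofReal (i : Fin n) (y : Fin n → ℝ) :
    form A d (simpleRoot i) (fun i => (y i : ℂ)) = ((gram A d *ᵥ y) i : ℝ) := by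
  rw [form_simpleRoot, gram_mulVec_apply]
  push_cast
  rfl

theorem IsSymmetrizableCartan.form_comm (hA : IsSymmetrizableCartan A d) (x y : Fin n → ℂ) :
    form A d x y = form A d y x := by
  simp only [form_apply, Finset.mul_sum]
  rw [Finset.sum_comm]
  refine Finset.sum_congr rfl fun i _ => Finset.sum_congr rfl fun j _ => ?_
  have : (d i : ℂ) * (A i j : ℂ) = (d j : ℂ) * (A j i : ℂ) := by exact_mod_cast hA.symm i j
  linear_combination (- x j * y i) * this

theorem eq_sum_simpleRoot (x : Fin n → ℂ) : x = ∑ i, x i • simpleRoot i := by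
  ext j
  simp [simpleRoot, Pi.single_apply]

theorem form_eq_zero_left_of_simpleRoot (hA : IsSymmetrizableCartan A d) {x : Fin n → ℂ}
    (h : ∀ i, form A d (simpleRoot i) x = 0) (v : Fin n → ℂ) : form A d x v = 0 := by
  rw [hA.form_comm, eq_sum_simpleRoot v]
  simp [h]

theorem mem_posImaginaryRoots_iff (hA : IsSymmetrizableCartan A d) (β : Fin n → ℕ) :
    β ∈ posImaginaryRoots A d ↔ β ≠ 0 ∧ gram A d *ᵥ (fun i => (β i : ℝ)) = 0 := by
  refine and_congr_right fun _ => ?_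
  have key (i : Fin n) : form A d (simpleRoot i) (fun i => (β i : ℂ)) =
      ((gram A d *ᵥ fun i => (β i : ℝ)) i : ℝ) := by
    simpa using form_simpleRoot_ofReal (A := A) (d := d) i (fun i => (β i : ℝ))
  constructor
  · intro h
    ext i
    have := h (simpleRoot i)
    rw [hA.form_comm, key] at this
    exact_mod_cast this
  · intro h
    exact form_eq_zero_left_of_simpleRoot hA fun i => by rw [key, h]; simp

theorem IsAffineType.pos_of_mem_posImaginaryRoots (haff : IsAffineType A d)
    (hA : IsSymmetrizableCartan A d) {β : Fin n → ℕ} (hβ : β ∈ posImaginaryRoots A d)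
    (i : Fin n) : 0 < β i := by
  obtain ⟨h0, h⟩ := (mem_posImaginaryRoots_iff hA β).1 hβ
  by_contra hi
  apply h0
  have := haff.eq_zero_of_apply_eq_zero (x := fun i => (β i : ℝ)) (i := i)
    (by simpa using hi) (by simp [h])
  ext j
  simpa using congrFun this j

/-- Kernel vectors are proportional, so a root minimizing one coordinate minimizes all of them, and
the separate coordinate minima are attained by a single root. -/
theorem IsAffineType.isLeast_deltaCoeff (haff : IsAffineType A d)
    (hA : IsSymmetrizableCartan A d) (a : Fin n) :
    IsLeast (posImaginaryRoots A d) (deltaCoeff A d) := by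
  have hne : {k | ∃ β ∈ posImaginaryRoots A d, β a = k}.Nonempty := by
    obtain ⟨β, hβ⟩ := haff.exists_nat_ne_zero hA
    exact ⟨_, β, (mem_posImaginaryRoots_iff hA β).2 hβ, rfl⟩
  obtain ⟨β, hβ, hβa⟩ := Nat.sInf_mem hne
  have hle : ∀ β' ∈ posImaginaryRoots A d, β ≤ β' := by
    intro β' hβ' j
    have h1 : β a ≤ β' a := hβa.trans_le (Nat.sInf_le ⟨β', hβ', rfl⟩)
    have hg := ((mem_posImaginaryRoots_iff hA β).1 hβ).2
    have hg' := ((mem_posImaginaryRoots_iff hA β').1 hβ').2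
    -- This combination cancels the coordinate `a`, so it is a kernel vector with a zero coordinate.
    have hprop := haff.eq_zero_of_apply_eq_zero (i := a)
      (x := (β a : ℝ) • (fun i => (β' i : ℝ)) - (β' a : ℝ) • (fun i => (β i : ℝ)))
      (by simp [mul_comm]) (by simp [Matrix.mulVec_sub, Matrix.mulVec_smul, hg, hg'])
    have hj : β a * β' j = β' a * β j := by
      have := congrFun hprop j
      simp only [Pi.sub_apply, Pi.smul_apply, smul_eq_mul, Pi.zero_apply, sub_eq_zero] at this
      exact_mod_cast this
    refine Nat.le_of_mul_le_mul_left ?_ (haff.pos_of_mem_posImaginaryRoots hA hβ a)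
    rw [hj]
    exact Nat.mul_le_mul_right _ h1
  have : deltaCoeff A d = β := by
    ext i
    refine le_antisymm (Nat.sInf_le ⟨β, hβ, rfl⟩) ?_
    obtain ⟨β', hβ', hi⟩ := Nat.sInf_mem
      (s := {k | ∃ β ∈ posImaginaryRoots A d, β i = k}) ⟨_, β, hβ, rfl⟩
    exact (hle β' hβ' i).trans_eq hi
  rw [this]
  exact ⟨hβ, hle⟩

/-- The coordinates of `δ`, as a real vector. -/
def deltaReal (A : Matrix (Fin n) (Fin n) ℤ) (d : Fin n → ℝ) : Fin n → ℝ :=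
  fun i => (deltaCoeff A d i : ℝ)

theorem delta_eq_ofReal : delta A d = fun i => (deltaReal A d i : ℂ) := by
  ext i
  simp [delta, deltaReal]

theorem IsAffineType.gram_mulVec_deltaReal (haff : IsAffineType A d)
    (hA : IsSymmetrizableCartan A d) : gram A d *ᵥ deltaReal A d = 0 := by
  ext i
  have := ((mem_posImaginaryRoots_iff hA _).1 (haff.isLeast_deltaCoeff hA i).1).2
  exact congrFun this i

theorem IsAffineType.deltaCoeff_pos (haff : IsAffineType A d)
    (hA : IsSymmetrizableCartan A d) (i : Fin n) : 0 < deltaCoeff A d i :=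
  haff.pos_of_mem_posImaginaryRoots hA (haff.isLeast_deltaCoeff hA i).1 i

theorem IsAffineType.delta_apply_ne_zero (haff : IsAffineType A d)
    (hA : IsSymmetrizableCartan A d) (i : Fin n) : delta A d i ≠ 0 := by
  simpa [delta] using (haff.deltaCoeff_pos hA i).ne'

theorem IsAffineType.form_delta (haff : IsAffineType A d)
    (hA : IsSymmetrizableCartan A d) (v : Fin n → ℂ) : form A d (delta A d) v = 0 := by
  refine form_eq_zero_left_of_simpleRoot hA (fun i => ?_) v
  rw [delta_eq_ofReal, form_simpleRoot_ofReal, haff.gram_mulVec_deltaReal hA]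
  simp

/-- Subtract the multiple of `δ` that kills the coordinate `a`; definiteness then applies to the
real and imaginary parts separately. -/
theorem IsAffineType.eq_smul_delta (haff : IsAffineType A d) (hA : IsSymmetrizableCartan A d)
    {v : Fin n → ℂ} (h : ∀ i, form A d (simpleRoot i) v = 0) (a : Fin n) :
    v = (v a / delta A d a) • delta A d := by
  rw [← sub_eq_zero]
  set w := v - (v a / delta A d a) • delta A d with hw
  have hwa : w a = 0 := by simp [hw, haff.delta_apply_ne_zero hA]
  have hwG (i : Fin n) : ∑ j, (A i j : ℂ) * w j = 0 := by
    have : form A d (simpleRoot i) w = 0 := by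
      rw [hw, map_sub, map_smul, h, hA.form_comm _ (delta A d), haff.form_delta hA]
      simp
    rw [form_simpleRoot] at this
    simpa [(hA.pos i).ne'] using this
  have hre : (fun i => (w i).re) = 0 := by
    refine haff.eq_zero_of_apply_eq_zero (i := a) (by simp [hwa]) ?_
    have : gram A d *ᵥ (fun i => (w i).re) = 0 := by
      ext i
      rw [gram_mulVec_apply]
      have := congrArg Complex.re (hwG i)
      simp only [Complex.re_sum, Complex.mul_re, Complex.intCast_re, Complex.intCast_im, zero_mul,
        sub_zero, Complex.zero_re] at this
      simp [this]
    simp [this]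
  have him : (fun i => (w i).im) = 0 := by
    refine haff.eq_zero_of_apply_eq_zero (i := a) (by simp [hwa]) ?_
    have : gram A d *ᵥ (fun i => (w i).im) = 0 := by
      ext i
      rw [gram_mulVec_apply]
      have := congrArg Complex.im (hwG i)
      simp only [Complex.im_sum, Complex.mul_im, Complex.intCast_re, Complex.intCast_im, zero_mul,
        add_zero, Complex.zero_im] at this
      simp [this]
    simp [this]
  ext i
  exact Complex.ext (congrFun hre i) (congrFun him i)

/-! ### Products of reflections and their fixed vectors -/

theorem simpleReflection_apply (i : Fin n) (x : Fin n → ℂ) :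
    simpleReflection A d i x = x - ((d i : ℂ)⁻¹ * form A d (simpleRoot i) x) • simpleRoot i := by
  simp [simpleReflection, simpleCoroot]

theorem IsSymmetrizableCartan.ofReal_ne_zero (hA : IsSymmetrizableCartan A d) (i : Fin n) :
    (d i : ℂ) ≠ 0 := by
  exact_mod_cast (hA.pos i).ne'

theorem IsSymmetrizableCartan.form_simpleRoot_self (hA : IsSymmetrizableCartan A d) (i : Fin n) :
    form A d (simpleRoot i) (simpleRoot i) = 2 * d i := by
  rw [form_simpleRoot, Finset.sum_eq_single i] <;> simp +contextual [simpleRoot, hA.diag, mul_comm]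

theorem IsSymmetrizableCartan.form_simpleReflection (hA : IsSymmetrizableCartan A d) (i : Fin n)
    (x y : Fin n → ℂ) :
    form A d (simpleReflection A d i x) (simpleReflection A d i y) = form A d x y := by
  simp only [simpleReflection_apply, map_sub, map_smul, LinearMap.sub_apply, LinearMap.smul_apply,
    smul_eq_mul, hA.form_simpleRoot_self, hA.form_comm x (simpleRoot i)]
  have := hA.ofReal_ne_zero i
  field_simp
  ring

theorem wordProd_cons (k : Fin n) (l : List (Fin n)) (x : Fin n → ℂ) :
    wordProd A d (k :: l) x = simpleReflection A d k (wordProd A d l x) := by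
  simp [wordProd]

theorem wordProd_nil (x : Fin n → ℂ) : wordProd A d [] x = x := by
  simp [wordProd]

theorem IsSymmetrizableCartan.form_wordProd (hA : IsSymmetrizableCartan A d) (l : List (Fin n))
    (x y : Fin n → ℂ) : form A d (wordProd A d l x) (wordProd A d l y) = form A d x y := by
  induction l with
  | nil => simp [wordProd_nil]
  | cons k l ih => rw [wordProd_cons, wordProd_cons, hA.form_simpleReflection, ih]

theorem IsAffineType.wordProd_delta (haff : IsAffineType A d) (hA : IsSymmetrizableCartan A d)
    (l : List (Fin n)) : wordProd A d l (delta A d) = delta A d := by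
  induction l with
  | nil => rw [wordProd_nil]
  | cons k l ih =>
    rw [wordProd_cons, ih, simpleReflection_apply, hA.form_comm, haff.form_delta hA]
    simp

theorem simpleReflection_apply_of_ne {i k : Fin n} (h : k ≠ i) (x : Fin n → ℂ) :
    simpleReflection A d i x k = x k := by
  simp [simpleReflection_apply, simpleRoot, h]

theorem wordProd_apply_of_notMem {l : List (Fin n)} {k : Fin n} (h : k ∉ l) (x : Fin n → ℂ) :
    wordProd A d l x k = x k := by
  induction l with
  | nil => rw [wordProd_nil]
  | cons j l ih =>
    rw [List.mem_cons, not_or] at h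
    rw [wordProd_cons, simpleReflection_apply_of_ne h.1, ih h.2]

/-- Only the first letter `k` changes the coordinate `k`, so its reflection must act trivially;
strip it off and repeat. -/
theorem IsSymmetrizableCartan.form_eq_zero_of_wordProd_eq (hA : IsSymmetrizableCartan A d)
    {l : List (Fin n)} (hl : l.Nodup) {v : Fin n → ℂ} (hv : wordProd A d l v = v) :
    ∀ k ∈ l, form A d (simpleRoot k) v = 0 := by
  induction l with
  | nil => simp
  | cons k l ih =>
    rw [List.nodup_cons] at hl
    have hk := wordProd_apply_of_notMem (A := A) (d := d) hl.1 v
    rw [wordProd_cons, simpleReflection_apply] at hv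
    have h0 : form A d (simpleRoot k) (wordProd A d l v) = 0 := by
      have := congrFun hv k
      simpa [simpleRoot, hk, hA.ofReal_ne_zero k] using this
    rw [h0, mul_zero, zero_smul, sub_zero] at hv
    intro j hj
    rcases List.mem_cons.1 hj with rfl | hj
    · rwa [hv] at h0
    · exact ih hl.2 hv j hj

theorem coxeterElement_eq_wordProd (aff : Fin n) (l r : List (Fin n)) :
    coxeterElement A d aff l r = wordProd A d (l ++ aff :: r) := by
  simp [coxeterElement, wordProd, mul_assoc]

/-! ### The generalized eigenvector -/

/-- The part of a vector supported on the letters of a word. -/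
def wordPart (w : Fin n → ℝ) (l : List (Fin n)) : Fin n → ℝ :=
  (l.map fun j => Pi.single j (w j)).sum

/-- The upper triangular half of the Gram matrix, with respect to the order of the letters in a
word, applied to a vector. -/
def upperGram (A : Matrix (Fin n) (Fin n) ℤ) (d w : Fin n → ℝ) : List (Fin n) → Fin n → ℝ
  | [] => 0
  | k :: l => upperGram A d w l + Pi.single k (d k * w k + (gram A d *ᵥ wordPart w l) k)

theorem wordPart_cons (w : Fin n → ℝ) (k : Fin n) (l : List (Fin n)) :
    wordPart w (k :: l) = Pi.single k (w k) + wordPart w l := by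
  simp [wordPart]

theorem wordPart_eq_self (w : Fin n → ℝ) {l : List (Fin n)} (hl : IsCoxeterWord l) :
    wordPart w l = w := by
  have hu : l.toFinset = Finset.univ := by ext; simp [hl.2]
  rw [wordPart, ← List.sum_toFinset _ hl.1, hu, Finset.univ_sum_single]

theorem upperGram_apply_of_notMem (w : Fin n → ℝ) {l : List (Fin n)} {k : Fin n} (h : k ∉ l) :
    upperGram A d w l k = 0 := by
  induction l with
  | nil => rfl
  | cons j l ih =>
    rw [List.mem_cons, not_or] at h
    simp [upperGram, ih h.2, h.1]

theorem IsSymmetrizableCartan.gram_isSymm (hA : IsSymmetrizableCartan A d) :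
    (gram A d).IsSymm := by
  ext i j
  exact hA.symm j i

theorem IsSymmetrizableCartan.dotProduct_gram_comm (hA : IsSymmetrizableCartan A d)
    (x y : Fin n → ℝ) : x ⬝ᵥ gram A d *ᵥ y = y ⬝ᵥ gram A d *ᵥ x := by
  rw [Matrix.dotProduct_mulVec, ← Matrix.mulVec_transpose, hA.gram_isSymm.eq, dotProduct_comm]

/-- A quadratic form only sees the symmetric part of `U`, which is half the Gram matrix. -/
theorem IsSymmetrizableCartan.two_mul_dotProduct_upperGram (hA : IsSymmetrizableCartan A d)
    (w : Fin n → ℝ) (l : List (Fin n)) :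
    2 * (w ⬝ᵥ upperGram A d w l) = wordPart w l ⬝ᵥ gram A d *ᵥ wordPart w l := by
  induction l with
  | nil => simp [wordPart, upperGram]
  | cons k l ih =>
    have h1 : Pi.single k (w k) ⬝ᵥ gram A d *ᵥ Pi.single k (w k) = 2 * d k * w k * w k := by
      simp [gram, hA.diag]
      ring
    rw [wordPart_cons, Matrix.mulVec_add, add_dotProduct, dotProduct_add, dotProduct_add, h1,
      hA.dotProduct_gram_comm (wordPart w l) (Pi.single k (w k)), ← ih, upperGram, dotProduct_add,
      dotProduct_single, single_dotProduct]
    ring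

/-- The hypothesis prescribes exactly that each reflection, on its turn, subtracts `w k • α_k`. -/
theorem IsSymmetrizableCartan.wordProd_eq_sub (hA : IsSymmetrizableCartan A d)
    (w : Fin n → ℝ) {l : List (Fin n)} (hl : l.Nodup) {v : Fin n → ℂ}
    (hv : ∀ k ∈ l, form A d (simpleRoot k) v = (upperGram A d w l k : ℝ)) :
    wordProd A d l v = v - fun i => (wordPart w l i : ℂ) := by
  induction l with
  | nil => ext; simp [wordProd_nil, wordPart]
  | cons k l ih =>
    rw [List.nodup_cons] at hl
    have hq := ih hl.2 fun j hj => by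
      have hjk : j ≠ k := fun h => hl.1 (h ▸ hj)
      rw [hv j (List.mem_cons_of_mem _ hj)]
      simp [upperGram, hjk]
    have hk := hv k List.mem_cons_self
    rw [upperGram, Pi.add_apply, upperGram_apply_of_notMem w hl.1, zero_add,
      Pi.single_eq_same] at hk
    rw [wordProd_cons, hq, simpleReflection_apply, map_sub, hk, form_simpleRoot_ofReal,
      wordPart_cons]
    have hd := hA.ofReal_ne_zero k
    have : (d k : ℂ)⁻¹ * (((d k * w k + (gram A d *ᵥ wordPart w l) k : ℝ) : ℂ) -
        ((gram A d *ᵥ wordPart w l) k : ℝ)) = w k := by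
      push_cast
      field_simp
      ring
    rw [this]
    ext i
    by_cases hi : i = k
    · subst hi
      simp [simpleRoot]
      ring
    · simp [simpleRoot, hi]

/-- The invertible principal minor without `a` solves all equations but one; pairing the error with
`δ`, whose coordinate at `a` is nonzero, gives the last. -/
theorem IsAffineType.exists_gram_mulVec_eq (haff : IsAffineType A d)
    (hA : IsSymmetrizableCartan A d) (a : Fin n) {y : Fin n → ℝ} (hy : deltaReal A d ⬝ᵥ y = 0) :
    ∃ g : Fin n → ℝ, g a = 0 ∧ gram A d *ᵥ g = y := by
  have hP := haff.posDef_erase a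
  set M := (gram A d).submatrix
    (fun j : ((Finset.univ.erase a : Finset (Fin n)) : Type) => (j : Fin n))
    (fun j : ((Finset.univ.erase a : Finset (Fin n)) : Type) => (j : Fin n)) with hM
  obtain ⟨h, hh⟩ := Matrix.mulVec_surjective_iff_isUnit.2 hP.isUnit (fun j => y j)
  let g : Fin n → ℝ := fun j => if hj : j = a then 0 else h ⟨j, by simp [hj]⟩
  have hg (j : ((Finset.univ.erase a : Finset (Fin n)) : Type)) : g j = h j := by
    have := (Finset.mem_erase.1 j.2).1
    simp [g, this]
  have hga : g a = 0 := by simp [g]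
  have hne {i : Fin n} (hi : i ≠ a) : (gram A d *ᵥ g) i = y i := by
    have := congrFun hh ⟨i, by simp [hi]⟩
    rw [← this]
    simp only [Matrix.mulVec, dotProduct, hM, Matrix.submatrix_apply, ← hg]
    exact (sum_coe_erase a (fun j => gram A d i j * g j) (by simp [hga])).symm
  refine ⟨g, hga, funext fun i => ?_⟩
  by_cases hi : i = a
  · subst hi
    have h1 : deltaReal A d ⬝ᵥ (gram A d *ᵥ g - y) = 0 := by
      rw [dotProduct_sub, hy, hA.dotProduct_gram_comm, haff.gram_mulVec_deltaReal hA]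
      simp
    rw [dotProduct, Finset.sum_eq_single i] at h1
    · have hpos := (haff.deltaCoeff_pos hA i).ne'
      simpa [deltaReal, hpos, sub_eq_zero] using h1
    · intro j _ hj
      simp [hne hj]
    · simp
  · exact hne hi

theorem IsAffineType.exists_wordProd_eq_add_delta (haff : IsAffineType A d)
    (hA : IsSymmetrizableCartan A d) (a : Fin n) {l : List (Fin n)} (hl : IsCoxeterWord l) :
    ∃ g : Fin n → ℝ, g a = 0 ∧
      wordProd A d l (fun i => (g i : ℂ)) = (fun i => (g i : ℂ)) + delta A d := by
  have h0 : deltaReal A d ⬝ᵥ upperGram A d (-deltaReal A d) l = 0 := by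
    have := hA.two_mul_dotProduct_upperGram (-deltaReal A d) l
    rw [wordPart_eq_self _ hl, Matrix.mulVec_neg, haff.gram_mulVec_deltaReal hA] at this
    simpa using this
  obtain ⟨g, hga, hg⟩ := haff.exists_gram_mulVec_eq hA a h0
  refine ⟨g, hga, ?_⟩
  rw [hA.wordProd_eq_sub (-deltaReal A d) hl.1 fun k _ => by rw [form_simpleRoot_ofReal, hg],
    wordPart_eq_self _ hl]
  ext i
  simp [deltaReal, delta]

/-! ### `V_fin`, `θ` and the finite element -/

theorem mem_Vfin_iff {a : Fin n} {v : Fin n → ℂ} : v ∈ Vfin a ↔ v a = 0 := by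
  constructor
  · intro h
    induction h using Submodule.span_induction with
    | mem x hx =>
      obtain ⟨i, hi, rfl⟩ := hx
      have : a ≠ i := Ne.symm hi
      simp [simpleRoot, this]
    | zero => rfl
    | add x y _ _ hx hy => simp [hx, hy]
    | smul c x _ hx => simp [hx]
  · intro h
    rw [eq_sum_simpleRoot v]
    refine Submodule.sum_mem _ fun i _ => ?_
    by_cases hi : i = a
    · simp [hi, h]
    · exact Submodule.smul_mem _ _ (Submodule.subset_span ⟨i, hi, rfl⟩)

theorem ofReal_mem_realSpan (g : Fin n → ℝ) : (fun i => (g i : ℂ)) ∈ realSpan n := by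
  have : (fun i => (g i : ℂ)) = ∑ i, g i • simpleRoot i := by
    ext j
    simp [simpleRoot, Pi.single_apply]
  rw [this]
  exact Submodule.sum_mem _ fun i _ => Submodule.smul_mem _ _ (Submodule.subset_span ⟨i, rfl⟩)

theorem theta_apply_self (a : Fin n) : theta A d a a = 0 := by
  simp [theta, delta, simpleRoot]

theorem IsAffineType.form_theta (haff : IsAffineType A d) (hA : IsSymmetrizableCartan A d)
    (a : Fin n) (x : Fin n → ℂ) :
    form A d (theta A d a) x = -((deltaCoeff A d a : ℂ) * form A d (simpleRoot a) x) := by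
  simp [theta, haff.form_delta hA]

theorem IsAffineType.form_coroot_theta (haff : IsAffineType A d) (hA : IsSymmetrizableCartan A d)
    (a : Fin n) (x : Fin n → ℂ) :
    form A d (coroot A d (theta A d a)) x =
      -((deltaCoeff A d a : ℂ)⁻¹ * ((d a : ℂ)⁻¹ * form A d (simpleRoot a) x)) := by
  have hm : (deltaCoeff A d a : ℂ) ≠ 0 := by exact_mod_cast (haff.deltaCoeff_pos hA a).ne'
  have hd := hA.ofReal_ne_zero a
  simp only [coroot, map_smul, LinearMap.smul_apply, haff.form_theta hA,
    hA.form_comm (simpleRoot a) (theta A d a), hA.form_simpleRoot_self, smul_eq_mul]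
  field_simp

/-- Modulo the radical, `θ` is a multiple of `α_aff`, so the two reflections differ only by a
multiple of `δ`. -/
theorem IsAffineType.reflection_theta_apply (haff : IsAffineType A d)
    (hA : IsSymmetrizableCartan A d) (a : Fin n) (x : Fin n → ℂ) :
    reflection A d (theta A d a) x = simpleReflection A d a x -
      form A d (coroot A d (theta A d a)) x • delta A d := by
  have hm : (deltaCoeff A d a : ℂ) ≠ 0 := by exact_mod_cast (haff.deltaCoeff_pos hA a).ne'
  simp only [reflection, LinearMap.sub_apply, LinearMap.id_apply, LinearMap.smulRight_apply,
    simpleReflection_apply, haff.form_coroot_theta hA]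
  rw [theta]
  ext i
  simp only [Pi.sub_apply, Pi.smul_apply, smul_eq_mul]
  field_simp
  ring

theorem IsAffineType.finiteElement_apply (haff : IsAffineType A d)
    (hA : IsSymmetrizableCartan A d) (a : Fin n) (l r : List (Fin n)) (x : Fin n → ℂ) :
    finiteElement A d a l r x = coxeterElement A d a l r x -
      form A d (coroot A d (theta A d a)) (wordProd A d r x) • delta A d := by
  simp [finiteElement, coxeterElement, haff.reflection_theta_apply hA, haff.wordProd_delta hA]

theorem finiteElement_apply_self (a : Fin n) {l r : List (Fin n)} (hl : a ∉ l) (hr : a ∉ r)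
    (x : Fin n → ℂ) : finiteElement A d a l r x a = x a := by
  simp [finiteElement, reflection, wordProd_apply_of_notMem hl, wordProd_apply_of_notMem hr,
    theta_apply_self]

/-! ### Finite order modulo `δ` -/

/-- Adding the square of one coordinate makes the form positive definite; `ε` is its minimum on the
compact unit sphere. -/
theorem IsAffineType.exists_norm_sq_le (haff : IsAffineType A d) (a : Fin n) :
    ∃ ε > 0, ∀ x : Fin n → ℝ, ε * ‖x‖ ^ 2 ≤ x ⬝ᵥ gram A d *ᵥ x + x a ^ 2 := by
  have : Nonempty (Fin n) := ⟨a⟩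
  have hcont : Continuous fun x : Fin n → ℝ => x ⬝ᵥ gram A d *ᵥ x + x a ^ 2 := by
    simp only [dotProduct, Matrix.mulVec]
    fun_prop
  obtain ⟨u, hu, hmin⟩ := (isCompact_sphere (0 : Fin n → ℝ) 1).exists_isMinOn
    (NormedSpace.sphere_nonempty.2 zero_le_one) hcont.continuousOn
  refine ⟨u ⬝ᵥ gram A d *ᵥ u + u a ^ 2, ?_, fun x => ?_⟩
  · have h1 := haff.dotProduct_gram_nonneg u
    refine lt_of_le_of_ne (by positivity) fun h => ?_
    have h2 : u a = 0 := by nlinarith [sq_nonneg (u a)]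
    have h3 := haff.eq_zero_of_apply_eq_zero h2 (by nlinarith [sq_nonneg (u a)])
    simp [h3] at hu
  · rcases eq_or_ne x 0 with rfl | hx
    · simp
    have hx' : ‖x‖ ≠ 0 := norm_ne_zero_iff.2 hx
    have := hmin (show ‖x‖⁻¹ • x ∈ Metric.sphere (0 : Fin n → ℝ) 1 by
      simp [norm_smul, hx'])
    simp only [Set.mem_ofPred_eq, Matrix.mulVec_smul, smul_dotProduct, dotProduct_smul,
      Pi.smul_apply, smul_eq_mul] at this
    calc _ ≤ (‖x‖⁻¹ * (‖x‖⁻¹ * (x ⬝ᵥ gram A d *ᵥ x)) + (‖x‖⁻¹ * x a) ^ 2) * ‖x‖ ^ 2 := by gcongr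
      _ = _ := by field_simp

theorem IsAffineType.finite_setOf_int_le (haff : IsAffineType A d) (a : Fin n) (R : ℝ) :
    {z : Fin n → ℤ | (fun i => (z i : ℝ)) ⬝ᵥ gram A d *ᵥ (fun i => (z i : ℝ)) +
      (z a : ℝ) ^ 2 ≤ R}.Finite := by
  obtain ⟨ε, hε, h⟩ := haff.exists_norm_sq_le a
  -- The summand `1` serves to bound a norm by its square: `2t ≤ 1 + t²`.
  obtain ⟨N, hN⟩ := exists_nat_gt (1 + R / ε)
  refine (Set.finite_Icc (fun _ => -(N : ℤ)) (fun _ => (N : ℤ))).subset fun z hz => ?_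
  have h1 := (h fun i => (z i : ℝ)).trans hz
  have h2 : ‖fun i => (z i : ℝ)‖ ^ 2 ≤ R / ε := by
    rw [le_div_iff₀ hε]
    linarith
  have h3 (i : Fin n) : |z i| ≤ (N : ℤ) := by
    have h4 : |(z i : ℝ)| ≤ ‖fun i => (z i : ℝ)‖ := norm_le_pi_norm (fun i => (z i : ℝ)) i
    have h5 : |(z i : ℝ)| ≤ N := by nlinarith [sq_nonneg (‖fun i => (z i : ℝ)‖ - 1)]
    exact_mod_cast h5
  exact ⟨fun i => (abs_le.1 (h3 i)).1, fun i => (abs_le.1 (h3 i)).2⟩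

theorem wordProd_intCast (hA : IsSymmetrizableCartan A d) (l : List (Fin n)) (z : Fin n → ℤ) :
    ∃ z' : Fin n → ℤ, wordProd A d l (fun i => (z i : ℂ)) = fun i => (z' i : ℂ) := by
  induction l with
  | nil => exact ⟨z, wordProd_nil _⟩
  | cons k l ih =>
    obtain ⟨y, hy⟩ := ih
    refine ⟨y - Pi.single k (∑ j, A k j * y j), ?_⟩
    rw [wordProd_cons, hy, simpleReflection_apply, form_simpleRoot,
      inv_mul_cancel_left₀ (hA.ofReal_ne_zero k)]
    ext i
    by_cases hi : i = k
    · subst hi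
      simp [simpleRoot]
    · simp [simpleRoot, hi]

theorem wordProd_pow (l : List (Fin n)) (k : ℕ) :
    ∃ l', wordProd A d l ^ k = wordProd A d l' := by
  induction k with
  | zero => exact ⟨[], by simp [wordProd]⟩
  | succ k ih =>
    obtain ⟨l', h⟩ := ih
    exact ⟨l' ++ l, by rw [pow_succ, h]; simp [wordProd]⟩

theorem IsSymmetrizableCartan.simpleReflection_involutive (hA : IsSymmetrizableCartan A d)
    (i : Fin n) : Function.Involutive (simpleReflection A d i) := by
  intro x
  have := hA.ofReal_ne_zero i
  have h : (d i : ℂ)⁻¹ * (2 * d i) = 2 := by field_simp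
  simp only [simpleReflection_apply, map_sub, map_smul, hA.form_simpleRoot_self, h]
  module

theorem IsSymmetrizableCartan.wordProd_injective (hA : IsSymmetrizableCartan A d)
    (l : List (Fin n)) : Function.Injective (wordProd A d l) := by
  induction l with
  | nil => exact fun x y h => by simpa [wordProd_nil] using h
  | cons k l ih =>
    intro x y h
    rw [wordProd_cons, wordProd_cons] at h
    exact ih ((hA.simpleReflection_involutive k).injective h)

/-- Pigeonhole: reduced modulo `δ`, the images of the simple roots under the powers of `c` range
over a finite set, and two powers that agree there can be cancelled. -/
theorem IsAffineType.exists_pow_wordProd_eq (haff : IsAffineType A d)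
    (hA : IsSymmetrizableCartan A d) (a : Fin n) (l : List (Fin n)) :
    ∃ m > 0, ∀ v, ∃ t : ℂ, (wordProd A d l ^ m) v = v + t • delta A d := by
  have hint (k : ℕ) (j : Fin n) : ∃ z : Fin n → ℤ,
      (wordProd A d l ^ k) (simpleRoot j) = fun i => (z i : ℂ) := by
    obtain ⟨l', hl'⟩ := wordProd_pow (A := A) (d := d) l k
    obtain ⟨z, hz⟩ := wordProd_intCast hA l' (Pi.single j 1)
    refine ⟨z, ?_⟩
    rw [hl', ← hz]
    congr 1
    ext i
    simp [simpleRoot, Pi.single_apply]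
  choose z hz using hint
  -- Floor division brings the coordinate `a` of `F k j` into the range from `0` to that of `δ`,
  -- without changing its norm `2 d_j`.
  let p : ℕ → Fin n → ℤ := fun k j => z k j a / deltaCoeff A d a
  let F : ℕ → Fin n → Fin n → ℤ := fun k j => z k j - p k j • fun i => (deltaCoeff A d i : ℤ)
  have hF (k : ℕ) : F k ∈ Set.univ.pi fun j => {z : Fin n → ℤ |
      (fun i => (z i : ℝ)) ⬝ᵥ gram A d *ᵥ (fun i => (z i : ℝ)) + (z a : ℝ) ^ 2 ≤
        2 * d j + (deltaCoeff A d a : ℝ) ^ 2} := by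
    intro j _
    have h1 : (fun i => (F k j i : ℝ)) = (fun i => (z k j i : ℝ)) - (p k j : ℝ) • deltaReal A d := by
      ext i
      simp [F, deltaReal]
    have h2 : (fun i => (z k j i : ℝ)) ⬝ᵥ gram A d *ᵥ (fun i => (z k j i : ℝ)) = 2 * d j := by
      obtain ⟨l', hl'⟩ := wordProd_pow (A := A) (d := d) l k
      have := hA.form_wordProd l' (simpleRoot j) (simpleRoot j)
      rw [← hl', hz, hA.form_simpleRoot_self] at this
      have h3 := form_ofReal (A := A) (d := d) (fun i => (z k j i : ℝ)) (fun i => (z k j i : ℝ))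
      simp only [Complex.ofReal_intCast] at h3
      rw [this] at h3
      exact_mod_cast h3.symm
    have h3 : F k j a = z k j a % deltaCoeff A d a := by
      simp [F, p, Int.emod_def, mul_comm]
    have hpos : (0 : ℤ) < deltaCoeff A d a := by exact_mod_cast haff.deltaCoeff_pos hA a
    have h4 : (0 : ℝ) ≤ F k j a := by
      rw [h3]
      exact_mod_cast Int.emod_nonneg _ hpos.ne'
    have h5 : (F k j a : ℝ) ≤ deltaCoeff A d a := by
      rw [h3]
      exact_mod_cast (Int.emod_lt_of_pos _ hpos).le
    simp only [Set.mem_ofPred_eq]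
    rw [h1, Matrix.mulVec_sub, Matrix.mulVec_smul, haff.gram_mulVec_deltaReal hA, smul_zero,
      sub_zero, sub_dotProduct, smul_dotProduct, hA.dotProduct_gram_comm (deltaReal A d),
      haff.gram_mulVec_deltaReal hA, dotProduct_zero, smul_zero, sub_zero, h2]
    gcongr
  obtain ⟨k, k', hkk, hEq⟩ := (Set.Finite.pi fun j => haff.finite_setOf_int_le a
    (2 * d j + (deltaCoeff A d a : ℝ) ^ 2)).exists_lt_map_eq_of_forall_mem
      (f := F) hF
  refine ⟨k' - k, Nat.sub_pos_of_lt hkk, ?_⟩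
  have hroot (j : Fin n) : (wordProd A d l ^ (k' - k)) (simpleRoot j) =
      simpleRoot j + ((p k' j - p k j : ℤ) : ℂ) • delta A d := by
    obtain ⟨l', hl'⟩ := wordProd_pow (A := A) (d := d) l k
    apply hA.wordProd_injective l'
    rw [map_add, map_smul, haff.wordProd_delta hA, ← hl', ← Module.End.mul_apply, ← pow_add,
      Nat.add_sub_cancel' hkk.le, hz, hz]
    ext i
    have := congrFun (congrFun hEq j) i
    simp only [F, Pi.sub_apply, Pi.smul_apply, smul_eq_mul] at this
    have h2 : (z k j i : ℂ) - p k j * deltaCoeff A d i =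
      z k' j i - p k' j * deltaCoeff A d i := by exact_mod_cast this
    simp only [Pi.add_apply, Pi.smul_apply, smul_eq_mul, delta]
    push_cast
    linear_combination -h2
  intro v
  refine ⟨∑ j, v j * ((p k' j - p k j : ℤ) : ℂ), ?_⟩
  conv_lhs => rw [eq_sum_simpleRoot v]
  simp only [map_sum, map_smul, hroot, smul_add, Finset.sum_add_distrib, Finset.sum_smul, smul_smul]
  rw [← eq_sum_simpleRoot v]

/-! ### Linear algebra of an endomorphism of finite order modulo a line -/

section LinearAlgebra

open Module

variable {V : Type*} [AddCommGroup V] [Module ℂ V]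

/-- Discrete Fourier decomposition over the cyclic orbit of `v`. -/
theorem exists_eq_sum_of_pow_apply_eq {c : End ℂ V} {m : ℕ} (hm : 0 < m) {ζ : ℂ}
    (hζ : IsPrimitiveRoot ζ m) {v : V} (hv : (c ^ m) v = v) :
    ∃ p : ℕ → V, v = ∑ j ∈ Finset.range m, p j ∧ ∀ j, c (p j) = ζ ^ j • p j := by
  have hζ0 : ζ ≠ 0 := hζ.ne_zero hm.ne'
  have hm0 : (m : ℂ) ≠ 0 := by exact_mod_cast hm.ne'
  have hinv : (ζ⁻¹) ^ m = 1 := by rw [inv_pow, hζ.pow_eq_one, inv_one]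
  refine ⟨fun j => (m : ℂ)⁻¹ • ∑ k ∈ Finset.range m, (ζ⁻¹ ^ (j * k)) • (c ^ k) v, ?_, fun j => ?_⟩
  · rw [← Finset.smul_sum, Finset.sum_comm, Finset.sum_eq_single_of_mem 0 (by simpa using hm)]
    · simp [← Nat.cast_smul_eq_nsmul ℂ, smul_smul, hm0]
    · intro k hk hk0
      rw [← Finset.sum_smul]
      have hne : ζ⁻¹ ^ k - 1 ≠ 0 := by
        rw [sub_ne_zero, inv_pow, ne_eq, inv_eq_one]
        exact hζ.pow_ne_one_of_pos_of_lt hk0 (Finset.mem_range.1 hk)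
      have hsum : ∑ j ∈ Finset.range m, ζ⁻¹ ^ (j * k) = 0 := by
        refine (mul_eq_zero.1 ?_).resolve_right hne
        rw [Finset.sum_congr rfl fun j _ => by rw [mul_comm, pow_mul], geom_sum_mul, ← pow_mul,
          mul_comm, pow_mul, hinv, one_pow, sub_self]
      rw [hsum, zero_smul]
  -- The shift is cyclic: the terms for `0` and `m` coincide.
  · have hshift : ∑ k ∈ Finset.range m, (ζ⁻¹ ^ (j * (k + 1))) • (c ^ (k + 1)) v =
        ∑ k ∈ Finset.range m, (ζ⁻¹ ^ (j * k)) • (c ^ k) v := by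
      have h1 := Finset.sum_range_succ (fun k => (ζ⁻¹ ^ (j * k)) • (c ^ k) v) m
      rw [Finset.sum_range_succ'] at h1
      have h2 : ζ⁻¹ ^ (j * m) = 1 := by rw [mul_comm, pow_mul, hinv, one_pow]
      simpa [hv, h2] using h1
    conv_rhs => rw [smul_comm, ← hshift, Finset.smul_sum]
    rw [map_smul, map_sum]
    refine congrArg _ (Finset.sum_congr rfl fun k _ => ?_)
    rw [map_smul, smul_smul, pow_succ' c, End.mul_apply, mul_add, pow_add, mul_one, mul_left_comm,
      ← mul_pow, mul_inv_cancel₀ hζ0, one_pow, mul_one]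

/-- An endomorphism that has finite order modulo a fixed line, and acts as a nontrivial Jordan
block on the generalized `1`-eigenvectors `δ` and `γ`. The functional `φ` is invariant and does not
vanish at `γ`. -/
structure IsAffineUnipotent (c : End ℂ V) (δ γ : V) (φ : V →ₗ[ℂ] ℂ) (m : ℕ) : Prop where
  ne_zero : δ ≠ 0
  apply_left : c δ = δ
  apply_right : c γ = γ + δ
  eq_smul : ∀ v, c v = v → ∃ t : ℂ, v = t • δ
  invariant : ∀ v, φ (c v) = φ v
  functional_ne_zero : φ γ ≠ 0
  pos : 0 < m
  pow_apply : ∀ v, ∃ t : ℂ, (c ^ m) v = v + t • δ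

/-- The eigenvectors whose eigenvalue is an `m`-th root of unity different from `1`. -/
def nontrivialEigenvectors (c : End ℂ V) (m : ℕ) : Set V :=
  {u | ∃ μ : ℂ, μ ≠ 1 ∧ μ ^ m = 1 ∧ c.HasEigenvector μ u}

namespace IsAffineUnipotent

variable {c : End ℂ V} {δ γ : V} {φ : V →ₗ[ℂ] ℂ} {m : ℕ}

theorem functional_left (h : IsAffineUnipotent c δ γ φ m) : φ δ = 0 := by
  simpa [h.apply_right] using h.invariant γ

theorem eigenspace_one (h : IsAffineUnipotent c δ γ φ m) :
    c.eigenspace 1 = Submodule.span ℂ {δ} := by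
  ext v
  rw [End.mem_eigenspace_iff, one_smul, Submodule.mem_span_singleton]
  constructor
  · intro hv
    obtain ⟨t, ht⟩ := h.eq_smul v hv
    exact ⟨t, ht.symm⟩
  · rintro ⟨t, rfl⟩
    rw [map_smul, h.apply_left]

theorem linearIndependent (h : IsAffineUnipotent c δ γ φ m) : LinearIndependent ℂ ![δ, γ] := by
  refine LinearIndependent.pair_iff.2 fun s t hst => ?_
  have ht : t = 0 := by
    have := congrArg φ hst
    simpa [h.functional_left, h.functional_ne_zero] using this
  refine ⟨?_, ht⟩
  simpa [ht, h.ne_zero] using hst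

/-- By induction `(c - 1) v = xδ + yγ`. Applying `φ` gives `y = 0`, and then `v - xγ` is fixed. -/
theorem maxGenEigenspace_one (h : IsAffineUnipotent c δ γ φ m) :
    c.maxGenEigenspace 1 = Submodule.span ℂ {δ, γ} := by
  apply le_antisymm
  · intro v hv
    obtain ⟨k, hk⟩ := (End.mem_maxGenEigenspace _ _ _).1 hv
    clear hv
    induction k generalizing v with
    | zero =>
      have : v = 0 := by simpa using hk
      rw [this]
      exact Submodule.zero_mem _
    | succ k ih =>
      rw [pow_succ, End.mul_apply] at hk
      obtain ⟨x, y, hxy⟩ := Submodule.mem_span_pair.1 (ih hk)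
      have hφ : φ ((c - (1 : ℂ) • 1) v) = 0 := by simp [h.invariant]
      have hy : y = 0 := by
        rw [← hxy] at hφ
        simpa [h.functional_left, h.functional_ne_zero] using hφ
      have hv : c v = v + x • δ := by
        have hxv : x • δ = c v - v := by simpa [hy] using hxy
        rw [hxv, add_sub_cancel]
      obtain ⟨t, ht⟩ := h.eq_smul (v - x • γ) (by
        rw [map_sub, map_smul, hv, h.apply_right]
        module)
      exact Submodule.mem_span_pair.2 ⟨t, x, by rw [← ht]; module⟩
  · rw [Submodule.span_le, Set.insert_subset_iff, Set.singleton_subset_iff]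
    refine ⟨(End.mem_maxGenEigenspace _ _ _).2 ⟨1, ?_⟩, (End.mem_maxGenEigenspace _ _ _).2 ⟨2, ?_⟩⟩
    · simp [h.apply_left]
    · simp [pow_two, h.apply_left, h.apply_right]

theorem finrank_span_pair (h : IsAffineUnipotent c δ γ φ m) :
    finrank ℂ (Submodule.span ℂ {δ, γ}) = 2 := by
  have := finrank_span_eq_card h.linearIndependent
  rwa [Matrix.range_cons_cons_empty, Fintype.card_fin] at this

theorem pow_apply_right (h : IsAffineUnipotent c δ γ φ m) (k : ℕ) :
    (c ^ k) γ = γ + (k : ℂ) • δ := by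
  induction k with
  | zero => simp
  | succ k ih =>
    rw [pow_succ', End.mul_apply, ih, map_add, map_smul, h.apply_left, h.apply_right]
    push_cast
    module

theorem exists_mem_span (h : IsAffineUnipotent c δ γ φ m) (v : V) :
    ∃ w ∈ Submodule.span ℂ (nontrivialEigenvectors c m), ∃ x y : ℂ, v = w + (x • δ + y • γ) := by
  have hm0 : (m : ℂ) ≠ 0 := by exact_mod_cast h.pos.ne'
  obtain ⟨t, ht⟩ := h.pow_apply v
  -- Since `c ^ m` moves `γ` by `m • δ`, the correction `(t / m) • γ` cancels the drift `t • δ` of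
  -- `v`. Below, `p 0` is the fixed component.
  obtain ⟨p, hp, hcp⟩ := exists_eq_sum_of_pow_apply_eq h.pos
    (Complex.isPrimitiveRoot_exp m h.pos.ne') (v := v - (t / m) • γ) (by
      rw [map_sub, map_smul, ht, h.pow_apply_right, smul_add, smul_smul, div_mul_cancel₀ _ hm0]
      abel)
  obtain ⟨k, hk⟩ : ∃ k, m = k + 1 := ⟨m - 1, by have := h.pos; omega⟩
  obtain ⟨x, hx⟩ := h.eq_smul (p 0) (by simpa using hcp 0)
  rw [hk, Finset.sum_range_succ', ← hk, hx] at hp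
  refine ⟨_, Submodule.sum_mem _ fun j hj => ?_, x, t / m,
    by rw [← add_assoc, ← hp, sub_add_cancel]⟩
  by_cases hpj : p (j + 1) = 0
  · rw [hpj]
    exact Submodule.zero_mem _
  · have hζ := Complex.isPrimitiveRoot_exp m h.pos.ne'
    refine Submodule.subset_span ⟨_, ?_, ?_, End.mem_eigenspace_iff.2 (hcp (j + 1)), hpj⟩
    · refine hζ.pow_ne_one_of_pos_of_lt (Nat.succ_ne_zero j) ?_
      have := Finset.mem_range.1 hj
      omega
    · rw [← pow_mul, mul_comm (j + 1), pow_mul, hζ.pow_eq_one, one_pow]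

theorem exists_linearIndependent_eigenvectors [FiniteDimensional ℂ V]
    (h : IsAffineUnipotent c δ γ φ m) :
    ∃ u : Fin (finrank ℂ V - 2) → V, LinearIndependent ℂ u ∧
      ∀ k, u k ∈ nontrivialEigenvectors c m := by
  obtain ⟨u, hu, -, hli⟩ := Submodule.exists_fun_fin_finrank_span_eq ℂ (nontrivialEigenvectors c m)
  have hle : finrank ℂ V - 2 ≤ finrank ℂ (Submodule.span ℂ (nontrivialEigenvectors c m)) := by
    have htop : Submodule.span ℂ (nontrivialEigenvectors c m) ⊔ Submodule.span ℂ {δ, γ} = ⊤ := by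
      refine eq_top_iff.2 fun v _ => ?_
      obtain ⟨w, hw, x, y, rfl⟩ := h.exists_mem_span v
      exact Submodule.add_mem_sup hw (Submodule.mem_span_pair.2 ⟨x, y, rfl⟩)
    have := Submodule.finrank_add_le_finrank_add_finrank
      (Submodule.span ℂ (nontrivialEigenvectors c m)) (Submodule.span ℂ {δ, γ})
    rw [htop, finrank_top, h.finrank_span_pair] at this
    omega
  exact ⟨u ∘ Fin.castLE hle, hli.comp _ (Fin.castLE_injective hle), fun k => hu _⟩

theorem functional_eq_zero_of_mem_eigenspace (h : IsAffineUnipotent c δ γ φ m) {μ : ℂ} {v : V}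
    (hv : v ∈ c.eigenspace μ) : φ v = 0 := by
  by_cases hμ : μ = 1
  · rw [hμ, h.eigenspace_one] at hv
    obtain ⟨t, rfl⟩ := Submodule.mem_span_singleton.1 hv
    simp [h.functional_left]
  · have := h.invariant v
    rw [End.mem_eigenspace_iff.1 hv, map_smul, smul_eq_mul] at this
    have h2 : (μ - 1) * φ v = 0 := by linear_combination this
    exact (mul_eq_zero.1 h2).resolve_left (sub_ne_zero.2 hμ)

/-- In the decomposition of `v` along eigenvectors, `δ` and `γ`, only the `γ`-term is seen by `φ`.
-/
theorem iSup_eigenspace (h : IsAffineUnipotent c δ γ φ m) :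
    ⨆ μ : ℂ, c.eigenspace μ = LinearMap.ker φ := by
  refine le_antisymm
    (iSup_le fun μ v hv => LinearMap.mem_ker.2 (h.functional_eq_zero_of_mem_eigenspace hv)) ?_
  intro v hv
  have hsub : Submodule.span ℂ (nontrivialEigenvectors c m) ≤ ⨆ μ : ℂ, c.eigenspace μ := by
    refine Submodule.span_le.2 ?_
    rintro u ⟨μ, -, -, hu⟩
    exact Submodule.mem_iSup_of_mem μ hu.1
  have hφ : Submodule.span ℂ (nontrivialEigenvectors c m) ≤ LinearMap.ker φ := by
    refine Submodule.span_le.2 ?_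
    rintro u ⟨μ, -, -, hu⟩
    exact LinearMap.mem_ker.2 (h.functional_eq_zero_of_mem_eigenspace hu.1)
  obtain ⟨w, hw, x, y, rfl⟩ := h.exists_mem_span v
  have hy : y = 0 := by
    rw [LinearMap.mem_ker, map_add, LinearMap.mem_ker.1 (hφ hw)] at hv
    simpa [h.functional_left, h.functional_ne_zero] using hv
  rw [hy, zero_smul, add_zero]
  refine Submodule.add_mem _ (hsub hw) (Submodule.mem_iSup_of_mem 1 ?_)
  rw [h.eigenspace_one]
  exact Submodule.smul_mem _ _ (Submodule.mem_span_singleton_self δ)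

end IsAffineUnipotent

end LinearAlgebra

end

end AffineCoxeter

/-! ### The main theorem -/

theorem proposition3p1 {n : ℕ} (A : Matrix (Fin n) (Fin n) ℤ) (d : Fin n → ℝ)
    (hA : IsSymmetrizableCartan A d) (haff : IsAffineType A d)
    (aff : Fin n) (l r : List (Fin n)) (hw : IsCoxeterWord (l ++ aff :: r)) :
    -- `δ` is the smallest positive imaginary root
    IsLeast (posImaginaryRoots A d) (deltaCoeff A d) ∧
    -- the eigenvalue `1`
    ((coxeterElement A d aff l r).charpoly.rootMultiplicity 1 = 2 ∧
      Module.finrank ℂ ((coxeterElement A d aff l r).eigenspace 1) = 1 ∧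
      (coxeterElement A d aff l r).HasEigenvector 1 (delta A d)) ∧
    -- the generalized `1`-eigenvector `γ_c`, and the span of all eigenvectors
    (∃ γ : Fin n → ℂ,
      (γ ∈ Vfin aff ∧ coxeterElement A d aff l r γ - γ = delta A d) ∧
      (∀ v ∈ Vfin aff, coxeterElement A d aff l r v - v = delta A d → v = γ) ∧
      γ ∈ realSpan n ∧
      (finiteElement A d aff l r γ = γ ∧
        form A d (coroot A d (theta A d aff)) (wordProd A d r γ) = 1) ∧
      (∀ v ∈ Vfin aff, finiteElement A d aff l r v = v →
        form A d (coroot A d (theta A d aff)) (wordProd A d r v) = 1 → v = γ) ∧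
      ⨆ μ : ℂ, (coxeterElement A d aff l r).eigenspace μ = LinearMap.ker (form A d γ)) ∧
    -- the eigenvectors with eigenvalue different from `1`
    (∃ u : Fin (n - 2) → (Fin n → ℂ), LinearIndependent ℂ u ∧
      ∀ k, ∃ μ : ℂ, μ ≠ 1 ∧ (∃ m : ℕ, 0 < m ∧ μ ^ m = 1) ∧
        (coxeterElement A d aff l r).HasEigenvector μ (u k)) ∧
    (∀ μ : ℂ, μ ≠ 1 → ∀ v ∈ Vfin aff,
      ((finiteElement A d aff l r).HasEigenvector μ v ↔
        (coxeterElement A d aff l r).HasEigenvector μ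
          (v + (form A d (coroot A d (theta A d aff)) (wordProd A d r v) / (μ - 1)) •
            delta A d))) := by
  have hwl : l.Nodup ∧ (aff :: r).Nodup ∧ l.Disjoint (aff :: r) := List.nodup_append'.1 hw.1
  have hal : aff ∉ l := fun h => hwl.2.2 h List.mem_cons_self
  have har : aff ∉ r := (List.nodup_cons.1 hwl.2.1).1
  have hδa := haff.delta_apply_ne_zero hA aff
  obtain ⟨g, hga, hg⟩ := haff.exists_wordProd_eq_add_delta hA aff hw
  obtain ⟨m, hm, hpow⟩ := haff.exists_pow_wordProd_eq hA aff (l ++ aff :: r)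
  rw [← coxeterElement_eq_wordProd] at hg hpow
  set c := coxeterElement A d aff l r with hc
  set γ : Fin n → ℂ := fun i => (g i : ℂ) with hγ
  have hγa : γ aff = 0 := by simp [hγ, hga]
  have hδ : c (delta A d) = delta A d := by
    rw [hc, coxeterElement_eq_wordProd, haff.wordProd_delta hA]
  have hfix : ∀ v, c v = v → v = (v aff / delta A d aff) • delta A d := fun v hv =>
    haff.eq_smul_delta hA (fun i => hA.form_eq_zero_of_wordProd_eq hw.1
      (by rwa [← coxeterElement_eq_wordProd]) i (hw.2 i)) aff
  have hinv : ∀ v w, form A d (c v) (c w) = form A d v w := fun v w => by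
    rw [hc, coxeterElement_eq_wordProd, hA.form_wordProd]
  have hc_aff : IsAffineUnipotent c (delta A d) γ (form A d γ) m :=
    { ne_zero := fun h => hδa (by rw [h]; rfl)
      apply_left := hδ
      apply_right := hg
      eq_smul := fun v hv => ⟨_, hfix v hv⟩
      invariant := fun v => by
        have := hinv γ v
        rwa [hg, map_add, LinearMap.add_apply, haff.form_delta hA, add_zero] at this
      functional_ne_zero := fun h => by
        rw [hγ, form_ofReal, Complex.ofReal_eq_zero] at h
        have hg0 := haff.eq_zero_of_apply_eq_zero hga h
        have hγ0 : γ = 0 := by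
          ext i
          simp [hγ, hg0]
        rw [hγ0, map_zero, zero_add] at hg
        exact hδa (by rw [← hg]; rfl)
      pos := hm
      pow_apply := hpow }
  -- Two solutions differ by a multiple of `δ`, which lies in `V_fin` only if it is zero.
  have huniq : ∀ v ∈ Vfin aff, c v - v = delta A d → v = γ := by
    intro v hv hcv
    have h1 := hfix (v - γ) (by
      rw [map_sub, hg, ← hcv]
      abel)
    rwa [Pi.sub_apply, mem_Vfin_iff.1 hv, hγa, sub_zero, zero_div, zero_smul, sub_eq_zero] at h1
  have hfin := haff.finiteElement_apply hA aff l r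
  rw [← hc] at hfin
  -- The finite element preserves the `α_aff`-coordinate, so its correction term must cancel the `δ`
  -- in `c γ = γ + δ`.
  have hk : form A d (coroot A d (theta A d aff)) (wordProd A d r γ) = 1 := by
    have h1 := congrFun (hfin γ) aff
    rw [finiteElement_apply_self aff hal har, hg, hγa] at h1
    simp only [Pi.sub_apply, Pi.add_apply, Pi.smul_apply, smul_eq_mul, hγa, zero_add] at h1
    have h2 : (form A d (coroot A d (theta A d aff)) (wordProd A d r γ) - 1) * delta A d aff = 0 := by
      linear_combination h1
    exact sub_eq_zero.1 ((mul_eq_zero.1 h2).resolve_right hδa)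
  refine ⟨haff.isLeast_deltaCoeff hA aff, ⟨?_, ?_, ?_⟩, ⟨γ, ⟨mem_Vfin_iff.2 hγa, ?_⟩, huniq,
    ofReal_mem_realSpan g, ⟨?_, hk⟩, ?_, hc_aff.iSup_eigenspace⟩, ?_, ?_⟩
  · rw [← LinearMap.finrank_maxGenEigenspace_eq, hc_aff.maxGenEigenspace_one,
      hc_aff.finrank_span_pair]
  · rw [hc_aff.eigenspace_one, finrank_span_singleton hc_aff.ne_zero]
  · exact ⟨Module.End.mem_eigenspace_iff.2 (by rw [one_smul, hδ]), hc_aff.ne_zero⟩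
  · rw [hg, add_sub_cancel_left]
  · rw [hfin, hg, hk, one_smul, add_sub_cancel_right]
  · intro v hv hfv hkv
    refine huniq v hv ?_
    rw [hfin, hkv, one_smul] at hfv
    rw [sub_eq_iff_eq_add] at hfv ⊢
    rw [hfv, add_comm]
  · have := hc_aff.exists_linearIndependent_eigenvectors
    rw [Module.finrank_fin_fun] at this
    obtain ⟨u, hu, h⟩ := this
    refine ⟨u, hu, fun k => ?_⟩
    obtain ⟨μ, h1, hμ, hμu⟩ := h k
    exact ⟨μ, h1, ⟨m, hm, hμ⟩, hμu⟩
  · intro μ hμ v hv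
    have hμ' : μ - 1 ≠ 0 := sub_ne_zero.2 hμ
    have hva := mem_Vfin_iff.1 hv
    rw [Module.End.hasEigenvector_iff, Module.End.hasEigenvector_iff,
      Module.End.mem_eigenspace_iff, Module.End.mem_eigenspace_iff, hfin, map_add, map_smul, hδ]
    set k := form A d (coroot A d (theta A d aff)) (wordProd A d r v) with hkdef
    have hkμ : k = μ * (k / (μ - 1)) - k / (μ - 1) := by
      field_simp
    -- The two eigenvector equations have the same defect, by `hkμ`. For nonvanishing, the
    -- `α_aff`-coordinate of the shifted vector comes from its `δ`-term alone.
    refine and_congr ?_ (not_congr ⟨fun h => ?_, fun h => ?_⟩)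
    · rw [smul_add, smul_smul, ← sub_eq_zero, ← sub_eq_zero (b := μ • v + _)]
      have : c v - k • delta A d - μ • v = c v + (k / (μ - 1)) • delta A d -
          (μ • v + (μ * (k / (μ - 1))) • delta A d) := by
        nth_rw 1 [hkμ]
        module
      rw [this]
    · rw [hkdef, h]
      simp
    · have h1 := congrFun h aff
      have h2 : k / (μ - 1) = 0 := by simpa [hva, hδa] using h1
      rwa [h2, zero_smul, add_zero] at h
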